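/- Let $M\in\mathbb N$ and $k>0$. Let $\mathbf A$ be the real symmetric tridiagonal $(M+1)\times(M+1)$ matrix with zero diagonal and with successive off-diagonal entries $\sqrt1,\sqrt2,\dots,\sqrt M$ (the $j$-th entry of the sub- and of the superdiagonal is $\sqrt j$, $1\le j\le M$). Let $\mathbf G$ be the $(M+1)\times(M+1)$ matrix whose only nonzero entry is a $1$ in the second row and first column. Let $\mathbf H=\mathrm{diag}\{h_0,h_1,\dots,h_M\}$ be a real diagonal matrix with $h_i\le 0$ for all $i$, $h_0=0$ and $h_M\neq 0$ (so that $M\ge 1$). For $m\in\mathbb Z\setminus\{0\}$ define \[ \mathbf G_m:=-\mathrm i\,mk\left(\mathbf A+\frac1{(mk)^2}\mathbf G\right)+\mathbf H . \] Then there exists a constant $\lambda^{(1)}>0$, independent of $m$, such that for every $m\in\mathbb Z\setminus\{0\}$ all the eigenvalues of $\mathbf G_m$ have real parts less than $-\lambda^{(1)}$. Furthermore, there exists a constant $C^{(4)}$, independent of $m$ and $t$, such that \[ \|\exp(t\mathbf G_m)\|_2\le C^{(4)}\,(t^M+1)\,\exp(-\lambda^{(1)}t)\qquad\text{for all } m\in\mathbb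 Z\setminus\{0\},\ t\ge 0, \] where $\|\cdot\|_2$ is the spectral norm (the operator norm induced by the Euclidean norm on $\mathbb C^{M+1}$). -/

import Mathlib

open scoped Matrix.Norms.L2Operator

noncomputable section

namespace HermiteFilter

/-- The `(M+1) × (M+1)` symmetric tridiagonal Hermite recursion matrix `A`: zero diagonal and
sub- and superdiagonals `√1, √2, …, √M` (indices start at `0`, so `A_{i,i+1} = A_{i+1,i} = √(i+1)`). -/
def hermiteMatrix (M : ℕ) : Matrix (Fin (M + 1)) (Fin (M + 1)) ℂ :=
  Matrix.of fun i j =>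
    if (i : ℕ) + 1 = j then ((Real.sqrt ((i : ℝ) + 1) : ℝ) : ℂ)
    else if (j : ℕ) + 1 = i then ((Real.sqrt ((j : ℝ) + 1) : ℝ) : ℂ)
    else 0

/-- The `(M+1) × (M+1)` matrix `G` whose only nonzero entry is a `1` in the second row and
first column. -/
def fieldMatrix (M : ℕ) : Matrix (Fin (M + 1)) (Fin (M + 1)) ℂ :=
  Matrix.of fun i j => if (i : ℕ) = 1 ∧ (j : ℕ) = 0 then 1 else 0

/-- The filter matrix `H = diag {h₀, …, h_M}`. -/
def filterMatrix {M : ℕ} (h : Fin (M + 1) → ℝ) : Matrix (Fin (M + 1)) (Fin (M + 1)) ℂ :=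
  Matrix.diagonal fun i => (h i : ℂ)

/-- A filter: non-positive diagonal entries, the first one zero and the last one nonzero. -/
structure IsFilter {M : ℕ} (h : Fin (M + 1) → ℝ) : Prop where
  nonpos : ∀ i, h i ≤ 0
  first : h 0 = 0
  last : h (Fin.last M) ≠ 0

/-- The matrix `G_m = -i m k (A + (m k)⁻² G) + H`. -/
def modeMatrix {M : ℕ} (k : ℝ) (h : Fin (M + 1) → ℝ) (m : ℤ) :
    Matrix (Fin (M + 1)) (Fin (M + 1)) ℂ :=
  (-(Complex.I * (m : ℂ) * (k : ℂ))) •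
      (hermiteMatrix M + (1 / ((m : ℂ) * (k : ℂ)) ^ 2) • fieldMatrix M) +
    filterMatrix h

end HermiteFilter

end

namespace HermiteFilter

open Finset

/-! The argument is hypocoercive. Rescaling the zeroth coordinate by `s`, with `s ^ 2 = 1 + 1 / (m *
k) ^ 2`, turns the flow of `modeMatrix` into a chain with symmetric hopping and damping `h`. The
energy of the chain is nonincreasing, but its derivative is only certain to see the damped last
site. The missing sites are recovered from the currents `α⁻¹ Im (conj (y j) * y (j + 1))`, where `α
= m * k`: their derivatives contain `-‖y j‖ ^ 2` up to terms at neighbouring sites, with constants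
uniform in `|α| ≥ k`. Working down from site `M`, `exists_lyapunov_rate` finds one combination of
energy and currents whose derivative controls every site. A multiple of the energy makes it
comparable to the energy, so `exists_chainEnergy_decay` gives exponential decay with constants
independent of `m`. Decay of all trajectories then bounds both the eigenvalues and the norm of the
exponential. -/

/-- The vector field of a damped chain with hopping amplitudes `a` and damping `h`. -/
noncomputable def chainField (α : ℝ) (a h : ℕ → ℝ) (y : ℕ → ℂ) (j : ℕ) : ℂ :=
  -(Complex.I * (α : ℂ)) * ((a j : ℂ) * y (j - 1) + (a (j + 1) : ℂ) * y (j + 1)) + (h j : ℂ) * y j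

/-- The squared norm of the first `M + 1` sites. -/
noncomputable def chainEnergy (M : ℕ) (y : ℕ → ℂ) : ℝ := ∑ j ∈ range (M + 1), ‖y j‖ ^ 2

/-- The derivative of the energy in the direction `v`. -/
noncomputable def chainEnergyRate (M : ℕ) (y v : ℕ → ℂ) : ℝ :=
  ∑ j ∈ range (M + 1), 2 * ((starRingEnd ℂ) (y j) * v j).re

/-- The current between neighbouring sites, rescaled by `α`. -/
noncomputable def chainCurrent (α : ℝ) (y : ℕ → ℂ) (j : ℕ) : ℝ :=
  α⁻¹ * ((starRingEnd ℂ) (y j) * y (j + 1)).im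

/-- The derivative of the rescaled current in the direction `v`. -/
noncomputable def chainCurrentRate (α : ℝ) (y v : ℕ → ℂ) (j : ℕ) : ℝ :=
  α⁻¹ * ((starRingEnd ℂ) (v j) * y (j + 1) + (starRingEnd ℂ) (y j) * v (j + 1)).im

/-! ### Energy and current identities and estimates -/

/-- The hopping contributions telescope; `a 0 = 0` and `y (M + 1) = 0` remove the two boundary
terms. The former also cancels the spurious neighbour `0 - 1 = 0`. -/
lemma chainEnergyRate_chainField {M : ℕ} {α : ℝ} {a h : ℕ → ℝ} {y : ℕ → ℂ}
    (ha : a 0 = 0) (hy : y (M + 1) = 0) :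
    chainEnergyRate M y (chainField α a h y) = ∑ j ∈ range (M + 1), 2 * (h j * ‖y j‖ ^ 2) := by
  have hterm : ∀ j, 2 * ((starRingEnd ℂ) (y j) * chainField α a h y j).re =
      2 * (h j * ‖y j‖ ^ 2) +
        ((2 * α * (a (j + 1) * ((starRingEnd ℂ) (y j) * y (j + 1)).im)) -
          2 * α * (a j * ((starRingEnd ℂ) (y (j - 1)) * y j).im)) := by
    intro j
    rw [← Complex.normSq_eq_norm_sq, Complex.normSq_apply]
    simp [chainField]
    ring
  have htel := Finset.sum_range_sub
    (fun j => 2 * α * (a j * ((starRingEnd ℂ) (y (j - 1)) * y j).im)) (M + 1)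
  simp only [Nat.add_sub_cancel] at htel
  unfold chainEnergyRate
  rw [Finset.sum_congr rfl fun j _ => hterm j, Finset.sum_add_distrib, htel]
  simp [ha, hy]

/-- The factor `α⁻¹` cancels the hopping strength, so only the damping term still depends on `α`,
and it is bounded when `|α|` is bounded below. -/
lemma chainCurrentRate_chainField {α : ℝ} (hα : α ≠ 0) (a h : ℕ → ℝ) (y : ℕ → ℂ) (j : ℕ) :
    chainCurrentRate α y (chainField α a h y) j =
      a (j + 1) * (‖y (j + 1)‖ ^ 2 - ‖y j‖ ^ 2) +
        (a j * ((starRingEnd ℂ) (y (j - 1)) * y (j + 1)).re -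
          a (j + 2) * ((starRingEnd ℂ) (y j) * y (j + 2)).re) +
        α⁻¹ * ((h j + h (j + 1)) * ((starRingEnd ℂ) (y j) * y (j + 1)).im) := by
  rw [← Complex.normSq_eq_norm_sq, Complex.normSq_apply, ← Complex.normSq_eq_norm_sq,
    Complex.normSq_apply]
  simp [chainCurrentRate, chainField]
  field_simp
  ring

lemma abs_re_conj_mul_le (z w : ℂ) : |((starRingEnd ℂ) z * w).re| ≤ ‖z‖ * ‖w‖ := by
  simpa using Complex.abs_re_le_norm ((starRingEnd ℂ) z * w)

lemma abs_im_conj_mul_le (z w : ℂ) : |((starRingEnd ℂ) z * w).im| ≤ ‖z‖ * ‖w‖ := by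
  simpa using Complex.abs_im_le_norm ((starRingEnd ℂ) z * w)

/-- Uniform bounds on the parameters of a chain of length `M + 1`. -/
structure ChainBounds (M : ℕ) (k K : ℝ) (α : ℝ) (a : ℕ → ℝ) : Prop where
  le_abs : k ≤ |α|
  zero : a 0 = 0
  nonneg : ∀ j, 0 ≤ a j
  le : ∀ j ≤ M + 1, a j ≤ K
  one_le : ∀ j, 1 ≤ j → 1 ≤ a j

lemma mul_le_mul_of_abs_le {c x K B : ℝ} (hc : |c| ≤ K) (hx : |x| ≤ B) : c * x ≤ K * B :=
  (le_abs_self _).trans <| by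
    rw [abs_mul]
    exact mul_le_mul hc hx (abs_nonneg _) ((abs_nonneg _).trans hc)

/-- Since `a (j + 1) ≥ 1`, site `j` contributes at most `-‖y j‖ ^ 2`; two applications of Young's
inequality cost a quarter each. The weight `η` of site `j - 1`, not yet controlled in a downward
induction, stays free. -/
lemma chainCurrentRate_le {M : ℕ} {k K R α : ℝ} {a h : ℕ → ℝ} (hk : 0 < k)
    (hR : ∀ j, |h j| ≤ R) (hb : ChainBounds M k K α a) (y : ℕ → ℂ) {j : ℕ} (hj : j < M)
    {η : ℝ} (hη : 0 < η) :
    chainCurrentRate α y (chainField α a h y) j ≤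
      -(1 / 2) * ‖y j‖ ^ 2 + η * ‖y (j - 1)‖ ^ 2 +
        (K + K ^ 2 / (4 * η) + K ^ 2 + (2 * R / k) ^ 2) *
          (‖y (j + 1)‖ ^ 2 + ‖y (j + 2)‖ ^ 2) := by
  have hα : α ≠ 0 := abs_pos.mp (hk.trans_le hb.le_abs)
  have hR0 : 0 ≤ R := (abs_nonneg _).trans (hR 0)
  rw [chainCurrentRate_chainField hα]
  have hK : 0 ≤ K := (hb.nonneg 0).trans (hb.le 0 (by omega))
  set p := ‖y j‖
  set q := ‖y (j - 1)‖
  set r := ‖y (j + 1)‖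
  set u := ‖y (j + 2)‖
  have hp : 0 ≤ p := norm_nonneg _
  have hq : 0 ≤ q := norm_nonneg _
  have hr : 0 ≤ r := norm_nonneg _
  have hu : 0 ≤ u := norm_nonneg _
  have h1 : a (j + 1) * (r ^ 2 - p ^ 2) ≤ K * r ^ 2 - p ^ 2 := by
    have := mul_le_mul_of_nonneg_right (hb.le (j + 1) (by omega)) (sq_nonneg r)
    have := mul_le_mul_of_nonneg_right (hb.one_le (j + 1) (by omega)) (sq_nonneg p)
    linarith
  have habs : ∀ i ≤ M + 1, |a i| ≤ K := fun i hi => by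
    rw [abs_of_nonneg (hb.nonneg i)]
    exact hb.le i hi
  have h2 : a j * ((starRingEnd ℂ) (y (j - 1)) * y (j + 1)).re ≤ K * (q * r) :=
    mul_le_mul_of_abs_le (habs j (by omega)) (abs_re_conj_mul_le _ _)
  have h3 : a (j + 2) * -((starRingEnd ℂ) (y j) * y (j + 2)).re ≤ K * (p * u) :=
    mul_le_mul_of_abs_le (habs (j + 2) (by omega)) ((abs_neg _).trans_le (abs_re_conj_mul_le _ _))
  have h4 : α⁻¹ * ((h j + h (j + 1)) * ((starRingEnd ℂ) (y j) * y (j + 1)).im) ≤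
      (2 * R / k) * (p * r) := by
    rw [← mul_assoc]
    refine mul_le_mul_of_abs_le ?_ (abs_im_conj_mul_le _ _)
    rw [abs_mul, abs_inv, div_eq_inv_mul]
    refine mul_le_mul (inv_anti₀ hk hb.le_abs) ?_ (abs_nonneg _) (by positivity)
    linarith [abs_add_le (h j) (h (j + 1)), hR j, hR (j + 1)]
  have h5 : K * (q * r) ≤ η * q ^ 2 + K ^ 2 / (4 * η) * r ^ 2 := by
    have : η * q ^ 2 + K ^ 2 / (4 * η) * r ^ 2 - K * (q * r) =
        η * (q - K / (2 * η) * r) ^ 2 := by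
      field_simp
      ring
    have : 0 ≤ η * (q - K / (2 * η) * r) ^ 2 := by positivity
    linarith
  have h6 : K * (p * u) ≤ 1 / 4 * p ^ 2 + K ^ 2 * u ^ 2 := by
    nlinarith [sq_nonneg (p / 2 - K * u)]
  have h7 : (2 * R / k) * (p * r) ≤ 1 / 4 * p ^ 2 + (2 * R / k) ^ 2 * r ^ 2 := by
    nlinarith [sq_nonneg (p / 2 - (2 * R / k) * r)]
  have h8 : 0 ≤ (K + K ^ 2 / (4 * η) + (2 * R / k) ^ 2) * u ^ 2 := by positivity
  have h9 : 0 ≤ K ^ 2 * r ^ 2 := by positivity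
  linarith

/-- Downward induction on `j`: the current at `j` adds control of site `j`, at the price of sites
above, already controlled, and of a small multiple of site `j - 1`. The weights `L` and `δ` are
chosen before `α`, `a` and `y`, which is the source of uniformity. -/
lemma exists_lyapunov_rate {M : ℕ} {k K R : ℝ} {h : ℕ → ℝ} (hk : 0 < k)
    (hR : ∀ j, |h j| ≤ R) (hneg : ∀ j, h j ≤ 0) (hM : h M ≠ 0) {j : ℕ} (hj : j ≤ M) :
    ∀ η : ℝ, 0 < η → ∃ L : ℝ, 0 ≤ L ∧ ∃ δ : ℕ → ℝ, ∀ (α : ℝ) (a : ℕ → ℝ) (y : ℕ → ℂ),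
      ChainBounds M k K α a → (∀ i, M < i → y i = 0) →
      L * chainEnergyRate M y (chainField α a h y) +
          ∑ i ∈ range M, δ i * chainCurrentRate α y (chainField α a h y) i ≤
        -(∑ i ∈ Ico j (M + 1), ‖y i‖ ^ 2) + η * ‖y (j - 1)‖ ^ 2 := by
  induction hj using Nat.decreasingInduction with
  | self =>
    intro η hη
    have hM' : 0 < -h M := by
      have := lt_of_le_of_ne (hneg M) hM
      linarith
    -- This weight normalizes the damping of site `M` to `-‖y M‖ ^ 2`.
    refine ⟨1 / (2 * -h M), by positivity, 0, fun α a y hb hy => ?_⟩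
    rw [chainEnergyRate_chainField hb.zero (hy _ (by omega)), Finset.sum_range_succ]
    have h1 : ∑ i ∈ range M, 2 * (h i * ‖y i‖ ^ 2) ≤ 0 :=
      Finset.sum_nonpos fun i _ => by nlinarith [hneg i, sq_nonneg ‖y i‖]
    have h2 : 1 / (2 * -h M) * ∑ i ∈ range M, 2 * (h i * ‖y i‖ ^ 2) ≤ 0 :=
      mul_nonpos_of_nonneg_of_nonpos (by positivity) h1
    have h3 : 1 / (2 * -h M) * (2 * (h M * ‖y M‖ ^ 2)) = -‖y M‖ ^ 2 := by
      field_simp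
    have h4 : 0 ≤ η * ‖y (M - 1)‖ ^ 2 := by positivity
    simp only [Pi.zero_apply, zero_mul, Finset.sum_const_zero, Nat.Ico_succ_singleton,
      Finset.sum_singleton, mul_add]
    linarith
  | of_succ j hj ih =>
    intro η hη
    set W := K + K ^ 2 / (4 * (η / 4)) + K ^ 2 + (2 * R / k) ^ 2 with hW
    by_cases hW0 : 0 ≤ W
    swap
    -- `K` is an arbitrary real; if `W < 0` then no chain satisfies the bounds and the claim is
    -- vacuous.
    · refine ⟨0, le_rfl, 0, fun α a y hb hy => absurd ?_ hW0⟩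
      have hK : 0 ≤ K := (hb.nonneg 0).trans (hb.le 0 (by omega))
      positivity
    -- After scaling by `4 * (2 * W + 1)` the error at site `j` is exactly `‖y j‖ ^ 2`, half of what
    -- four times the current gains, and the tail term `-4 * (2 * W + 1) * T` outweighs the loss `8
    -- * W * T`.
    obtain ⟨L, hL, δ, hQ⟩ := ih (1 / (4 * (2 * W + 1))) (by positivity)
    refine ⟨4 * (2 * W + 1) * L, by positivity,
      fun i => 4 * (2 * W + 1) * δ i + if i = j then 4 else 0, fun α a y hb hy => ?_⟩
    have h1 := mul_le_mul_of_nonneg_left (hQ α a y hb hy)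
      (show 0 ≤ 4 * (2 * W + 1) by positivity)
    have h2 := chainCurrentRate_le hk hR hb y hj (show 0 < η / 4 by positivity)
    rw [← hW] at h2
    set T := ∑ i ∈ Ico (j + 1) (M + 1), ‖y i‖ ^ 2 with hT
    have h3 : ‖y (j + 1)‖ ^ 2 ≤ T :=
      Finset.single_le_sum (f := fun i => ‖y i‖ ^ 2) (fun i _ => sq_nonneg _)
        (Finset.mem_Ico.mpr ⟨le_rfl, by omega⟩)
    have h4 : ‖y (j + 2)‖ ^ 2 ≤ T := by
      by_cases hj2 : j + 2 ≤ M
      · exact Finset.single_le_sum (f := fun i => ‖y i‖ ^ 2) (fun i _ => sq_nonneg _)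
          (Finset.mem_Ico.mpr ⟨by omega, by omega⟩)
      · rw [hy (j + 2) (by omega)]
        simpa using (sq_nonneg _).trans h3
    have h5 : W * (‖y (j + 1)‖ ^ 2 + ‖y (j + 2)‖ ^ 2) ≤ W * (2 * T) :=
      mul_le_mul_of_nonneg_left (by linarith) hW0
    have h6 : ∑ i ∈ range M, (4 * (2 * W + 1) * δ i + if i = j then 4 else 0) *
          chainCurrentRate α y (chainField α a h y) i =
        4 * (2 * W + 1) * ∑ i ∈ range M, δ i * chainCurrentRate α y (chainField α a h y) i +
          4 * chainCurrentRate α y (chainField α a h y) j := by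
      simp only [add_mul, Finset.sum_add_distrib, ite_mul, zero_mul, Finset.sum_ite_eq',
        Finset.mem_range, if_pos hj, Finset.mul_sum, mul_assoc]
    have h7 : 4 * (2 * W + 1) * (1 / (4 * (2 * W + 1)) * ‖y (j + 1 - 1)‖ ^ 2) = ‖y j‖ ^ 2 := by
      rw [Nat.add_sub_cancel]
      field_simp
    rw [mul_add, mul_add _ (-T), h7] at h1
    beta_reduce
    rw [h6, Finset.sum_eq_sum_Ico_succ_bot (show j < M + 1 by omega), ← hT]
    have h8 : 0 ≤ T := (sq_nonneg _).trans h3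
    linarith

/-! ### Exponential decay for damped chains -/

lemma chainEnergy_nonneg (M : ℕ) (y : ℕ → ℂ) : 0 ≤ chainEnergy M y :=
  Finset.sum_nonneg fun _ _ => sq_nonneg _

lemma abs_chainCurrent_le {M : ℕ} {k α : ℝ} (hk : 0 < k) (hα : k ≤ |α|) (y : ℕ → ℂ) {j : ℕ}
    (hj : j < M) : |chainCurrent α y j| ≤ k⁻¹ * chainEnergy M y := by
  have hs : ∀ i ≤ M, ‖y i‖ ^ 2 ≤ chainEnergy M y := fun i hi =>
    Finset.single_le_sum (f := fun i => ‖y i‖ ^ 2) (fun i _ => sq_nonneg _)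
      (Finset.mem_range.mpr (by omega))
  rw [chainCurrent, abs_mul, abs_inv]
  refine mul_le_mul (inv_anti₀ hk hα) ((abs_im_conj_mul_le _ _).trans ?_) (abs_nonneg _)
    (by positivity)
  nlinarith [hs j (by omega), hs (j + 1) (by omega), sq_nonneg (‖y j‖ - ‖y (j + 1)‖)]

lemma hasDerivAt_chainEnergy {M : ℕ} {y : ℝ → ℕ → ℂ} {v : ℕ → ℂ} {t : ℝ}
    (hy : ∀ j ≤ M, HasDerivAt (fun t => y t j) (v j) t) :
    HasDerivAt (fun t => chainEnergy M (y t)) (chainEnergyRate M (y t) v) t := by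
  unfold chainEnergy chainEnergyRate
  refine HasDerivAt.fun_sum fun j hj => ?_
  refine (hy j (by simpa [Nat.lt_succ_iff] using hj)).norm_sq.congr_deriv ?_
  rw [Complex.inner, mul_comm (v j)]

lemma hasDerivAt_chainCurrent {M : ℕ} {α : ℝ} {y : ℝ → ℕ → ℂ} {v : ℕ → ℂ} {t : ℝ}
    (hy : ∀ j ≤ M, HasDerivAt (fun t => y t j) (v j) t) {j : ℕ} (hj : j < M) :
    HasDerivAt (fun t => chainCurrent α (y t) j) (chainCurrentRate α (y t) v j) t := by
  have h1 : HasDerivAt (fun t => (starRingEnd ℂ) (y t j)) ((starRingEnd ℂ) (v j)) t :=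
    (hy j hj.le).star
  exact (Complex.imCLM.hasFDerivAt.comp_hasDerivAt t (h1.mul (hy (j + 1) hj))).const_mul α⁻¹

/-- Trajectories of a chain damped at its last site decay exponentially, uniformly in the
parameters of the chain. -/
theorem exists_chainEnergy_decay {M : ℕ} {k K R : ℝ} {h : ℕ → ℝ} (hk : 0 < k)
    (hR : ∀ j, |h j| ≤ R) (hneg : ∀ j, h j ≤ 0) (hM : h M ≠ 0) :
    ∃ c : ℝ, 0 < c ∧ ∃ C : ℝ, 0 < C ∧ ∀ (α : ℝ) (a : ℕ → ℝ) (y : ℝ → ℕ → ℂ),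
      ChainBounds M k K α a → (∀ t i, M < i → y t i = 0) →
      (∀ t, ∀ j ≤ M, HasDerivAt (fun t => y t j) (chainField α a h (y t) j) t) →
      ∀ t, 0 ≤ t → chainEnergy M (y t) ≤ C * Real.exp (-c * t) * chainEnergy M (y 0) := by
  obtain ⟨L, hL, δ, hQ⟩ :=
    exists_lyapunov_rate (K := K) hk hR hneg hM (Nat.zero_le M) (1 / 2) (by norm_num)
  set D := ∑ i ∈ range M, |δ i| * k⁻¹ with hD
  have hD0 : 0 ≤ D := Finset.sum_nonneg fun i _ => by positivity
  set B := L + 2 * D + 1 with hB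
  have hB0 : 0 < B := by positivity
  refine ⟨1 / (2 * B), by positivity, B, hB0, fun α a y hb hy hd t ht => ?_⟩
  -- The extra `D + 1` copies of the energy dominate the currents, so that `P` lies between the
  -- energy and `B` times it.
  set P : ℝ → ℝ := fun t => (L + D + 1) * chainEnergy M (y t) +
    ∑ i ∈ range M, δ i * chainCurrent α (y t) i with hP
  have hcur : ∀ t, |∑ i ∈ range M, δ i * chainCurrent α (y t) i| ≤ D * chainEnergy M (y t) := by
    intro t
    refine (Finset.abs_sum_le_sum_abs _ _).trans ?_
    rw [hD, Finset.sum_mul]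
    refine Finset.sum_le_sum fun i hi => ?_
    rw [abs_mul, mul_assoc]
    exact mul_le_mul_of_nonneg_left
      (abs_chainCurrent_le hk hb.le_abs _ (Finset.mem_range.mp hi)) (abs_nonneg _)
  have hlow : ∀ t, chainEnergy M (y t) ≤ P t := fun t => by
    have := (abs_le.mp (hcur t)).1
    have := mul_nonneg hL (chainEnergy_nonneg M (y t))
    simp only [hP]
    linarith
  have hupp : ∀ t, P t ≤ B * chainEnergy M (y t) := fun t => by
    have := (abs_le.mp (hcur t)).2
    simp only [hP, hB]
    linarith
  set P' : ℝ → ℝ := fun t => (L + D + 1) * chainEnergyRate M (y t) (chainField α a h (y t)) +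
    ∑ i ∈ range M, δ i * chainCurrentRate α (y t) (chainField α a h (y t)) i with hP'
  have hderiv : ∀ t, HasDerivAt P (P' t) t := fun t =>
    ((hasDerivAt_chainEnergy (hd t)).const_mul _).add <| HasDerivAt.fun_sum fun i hi =>
      (hasDerivAt_chainCurrent (hd t) (Finset.mem_range.mp hi)).const_mul _
  have hrate : ∀ t, P' t ≤ -(1 / (2 * B)) * P t := by
    intro t
    have h1 := hQ α a (y t) hb (hy t)
    have h2 : chainEnergyRate M (y t) (chainField α a h (y t)) ≤ 0 := by
      rw [chainEnergyRate_chainField hb.zero (hy t _ (by omega))]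
      exact Finset.sum_nonpos fun i _ => by nlinarith [hneg i, sq_nonneg ‖y t i‖]
    have h3 := mul_nonpos_of_nonneg_of_nonpos (show 0 ≤ D + 1 by positivity) h2
    rw [← Finset.range_eq_Ico] at h1
    change _ ≤ -(chainEnergy M (y t)) + _ at h1
    -- At `j = 0` truncated subtraction makes the error `1 / 2 * ‖y t 0‖ ^ 2`, absorbed by half of
    -- the energy.
    have h4 : ‖y t (0 - 1)‖ ^ 2 ≤ chainEnergy M (y t) :=
      Finset.single_le_sum (f := fun i => ‖y t i‖ ^ 2) (fun i _ => sq_nonneg _)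
        (Finset.mem_range.mpr (by omega))
    have h5 : 1 / (2 * B) * P t ≤ 1 / 2 * chainEnergy M (y t) := by
      refine (mul_le_mul_of_nonneg_left (hupp t) (by positivity)).trans_eq ?_
      field_simp
    simp only [hP']
    linarith
  have hanti : Antitone fun t => Real.exp (1 / (2 * B) * t) * P t := by
    have hder : ∀ t, HasDerivAt (fun t => Real.exp (1 / (2 * B) * t) * P t)
        (Real.exp (1 / (2 * B) * t) * (1 / (2 * B) * 1) * P t +
          Real.exp (1 / (2 * B) * t) * P' t) t := fun t =>
      (((hasDerivAt_id t).const_mul (1 / (2 * B))).exp).mul (hderiv t)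
    refine antitone_of_deriv_nonpos (fun t => (hder t).differentiableAt) fun t => ?_
    rw [(hder t).deriv]
    have := mul_le_mul_of_nonneg_left (hrate t) (Real.exp_pos (1 / (2 * B) * t)).le
    linarith
  have h0 := hanti ht
  simp only [mul_zero, Real.exp_zero, one_mul] at h0
  calc chainEnergy M (y t) ≤ P t := hlow t
    _ = Real.exp (-(1 / (2 * B)) * t) * (Real.exp (1 / (2 * B) * t) * P t) := by
      rw [← mul_assoc, ← Real.exp_add]
      simp
    _ ≤ Real.exp (-(1 / (2 * B)) * t) * (B * chainEnergy M (y 0)) :=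
      mul_le_mul_of_nonneg_left (h0.trans (hupp 0)) (Real.exp_pos _).le
    _ = B * Real.exp (-(1 / (2 * B)) * t) * chainEnergy M (y 0) := by ring

/-! ### Symmetrization of the mode matrix -/

/-- Extension of a finite family by zero to all of `ℕ`. -/
def extendZero {R : Type*} [Zero R] {M : ℕ} (x : Fin (M + 1) → R) (j : ℕ) : R :=
  if hj : j < M + 1 then x ⟨j, hj⟩ else 0

lemma extendZero_val {R : Type*} [Zero R] {M : ℕ} (x : Fin (M + 1) → R) (i : Fin (M + 1)) :
    extendZero x i = x i := by
  rw [extendZero, dif_pos i.isLt]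

lemma extendZero_of_lt {R : Type*} [Zero R] {M : ℕ} (x : Fin (M + 1) → R) {j : ℕ} (hj : M < j) :
    extendZero x j = 0 := by
  rw [extendZero, dif_neg (by omega)]

lemma hermiteMatrix_mulVec {M : ℕ} (x : Fin (M + 1) → ℂ) (j : Fin (M + 1)) :
    (hermiteMatrix M).mulVec x j =
      ((Real.sqrt (j : ℕ) : ℝ) : ℂ) * extendZero x (j - 1) +
        ((Real.sqrt ((j + 1 : ℕ) : ℝ) : ℝ) : ℂ) * extendZero x (j + 1) := by
  have hterm : ∀ i : Fin (M + 1), hermiteMatrix M j i * x i =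
      (if (j : ℕ) - 1 = i then ((Real.sqrt (j : ℕ) : ℝ) : ℂ) * extendZero x (j - 1) else 0) +
        (if (j : ℕ) + 1 = i then
          ((Real.sqrt ((j + 1 : ℕ) : ℝ) : ℝ) : ℂ) * extendZero x (j + 1) else 0) := by
    intro i
    rw [← extendZero_val x i]
    simp only [hermiteMatrix, Matrix.of_apply]
    by_cases h1 : (j : ℕ) + 1 = i
    · rw [if_pos h1, if_neg (show ¬(j : ℕ) - 1 = i by omega), if_pos h1, zero_add, ← h1]
      push_cast
      rfl
    · rw [if_neg h1, if_neg h1, add_zero]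
      by_cases h2 : (i : ℕ) + 1 = j
      · rw [if_pos h2, if_pos (show (j : ℕ) - 1 = i by omega), ← h2, Nat.add_sub_cancel]
        push_cast
        rfl
      · rw [if_neg h2, zero_mul]
        split_ifs with h3
        · rw [show (j : ℕ) = 0 by omega]
          simp
        · rfl
  rw [Matrix.mulVec, dotProduct, Finset.sum_congr rfl fun i _ => hterm i,
    Finset.sum_add_distrib,
    Fin.sum_univ_eq_sum_range (fun i => if (j : ℕ) - 1 = i then
      ((Real.sqrt (j : ℕ) : ℝ) : ℂ) * extendZero x (j - 1) else 0) (M + 1),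
    Fin.sum_univ_eq_sum_range (fun i => if (j : ℕ) + 1 = i then
      ((Real.sqrt ((j + 1 : ℕ) : ℝ) : ℝ) : ℂ) * extendZero x (j + 1) else 0) (M + 1),
    Finset.sum_ite_eq, Finset.sum_ite_eq, if_pos (Finset.mem_range.mpr (by omega))]
  congr 1
  split_ifs with hj
  · rfl
  · rw [extendZero_of_lt x (by simpa [Nat.lt_succ_iff] using hj), mul_zero]

lemma fieldMatrix_mulVec {M : ℕ} (x : Fin (M + 1) → ℂ) (j : Fin (M + 1)) :
    (fieldMatrix M).mulVec x j = if (j : ℕ) = 1 then extendZero x 0 else 0 := by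
  rw [Matrix.mulVec, dotProduct, Finset.sum_eq_single 0]
  · simp [fieldMatrix, ← extendZero_val x 0]
  · intro i _ hi
    have : (i : ℕ) ≠ 0 := fun h => hi (Fin.ext h)
    simp only [fieldMatrix, Matrix.of_apply, this, and_false, if_false, zero_mul]
  · simp

lemma modeMatrix_mulVec {M : ℕ} (k : ℝ) (h : Fin (M + 1) → ℝ) (m : ℤ) (x : Fin (M + 1) → ℂ)
    (j : Fin (M + 1)) :
    (modeMatrix k h m).mulVec x j =
      -(Complex.I * ((m * k : ℝ) : ℂ)) *
          (((Real.sqrt (j : ℕ) : ℝ) : ℂ) * extendZero x (j - 1) +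
            ((Real.sqrt ((j + 1 : ℕ) : ℝ) : ℝ) : ℂ) * extendZero x (j + 1) +
            ((1 / (m * k : ℝ) ^ 2 : ℝ) : ℂ) * if (j : ℕ) = 1 then extendZero x 0 else 0) +
        (h j : ℂ) * x j := by
  simp only [modeMatrix, Matrix.add_mulVec, Matrix.smul_mulVec, Pi.add_apply, Pi.smul_apply,
    hermiteMatrix_mulVec, fieldMatrix_mulVec, filterMatrix, Matrix.mulVec_diagonal, smul_eq_mul]
  push_cast
  ring

/-- The hopping amplitudes of the symmetrized mode matrix. -/
noncomputable def modeAmplitude (s : ℝ) (j : ℕ) : ℝ := if j = 1 then s else Real.sqrt j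

/-- The coordinates which symmetrize the mode matrix. -/
noncomputable def modeCoord (s : ℝ) {M : ℕ} (x : Fin (M + 1) → ℂ) (j : ℕ) : ℂ :=
  (if j = 0 then (s : ℂ) else 1) * extendZero x j

/-- Up to the factor `-i m k`, only the entries `s ^ 2` at `(1, 0)` and `1` at `(0, 1)` break
symmetry; scaling coordinate `0` by `s` turns both into `s`. -/
lemma modeCoord_mulVec {M : ℕ} {k s : ℝ} (h : Fin (M + 1) → ℝ) {m : ℤ}
    (hs : s ^ 2 = 1 + 1 / (m * k) ^ 2) (x : Fin (M + 1) → ℂ) {j : ℕ} (hj : j ≤ M) :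
    modeCoord s ((modeMatrix k h m).mulVec x) j =
      chainField (m * k) (modeAmplitude s) (extendZero h) (modeCoord s x) j := by
  lift j to Fin (M + 1) using Nat.lt_succ_of_le hj
  rw [modeCoord, extendZero_val, modeMatrix_mulVec, chainField, extendZero_val]
  have hsC : ((1 / (m * k : ℝ) ^ 2 : ℝ) : ℂ) = (s : ℂ) ^ 2 - 1 := by
    rw [← Complex.ofReal_pow, hs]
    push_cast
    ring
  rw [hsC]
  rcases hn : (j : ℕ) with _ | _ | n
  · simp [modeCoord, modeAmplitude, ← extendZero_val x j, hn]
    ring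
  · simp [modeCoord, modeAmplitude, ← extendZero_val x j, hn]
    left
    ring
  · simp [modeCoord, modeAmplitude, ← extendZero_val x j, hn]

lemma chainBounds_modeAmplitude {M : ℕ} {k s : ℝ} (hk : 0 < k) {m : ℤ} (hm : m ≠ 0)
    (hs0 : 0 ≤ s) (hs : s ^ 2 = 1 + 1 / (m * k) ^ 2) :
    ChainBounds M k (Real.sqrt (1 + 1 / k ^ 2) + Real.sqrt (M + 1)) (m * k) (modeAmplitude s) := by
  have hm1 : (1 : ℝ) ≤ |(m : ℝ)| := by exact_mod_cast Int.one_le_abs hm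
  have hle : k ≤ |(m : ℝ) * k| := by
    rw [abs_mul, abs_of_pos hk]
    nlinarith
  refine ⟨hle, by simp [modeAmplitude], fun j => ?_, fun j hj => ?_, fun j hj => ?_⟩ <;>
    unfold modeAmplitude <;> split_ifs with h1
  · exact hs0
  · positivity
  · refine le_add_of_le_of_nonneg (Real.le_sqrt_of_sq_le ?_) (Real.sqrt_nonneg _)
    rw [hs, ← sq_abs ((m : ℝ) * k)]
    gcongr
  · refine le_add_of_nonneg_of_le (Real.sqrt_nonneg _) (Real.sqrt_le_sqrt ?_)
    exact_mod_cast hj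
  · have : 0 ≤ 1 / ((m : ℝ) * k) ^ 2 := by positivity
    nlinarith
  · rw [Real.one_le_sqrt]
    exact_mod_cast hj

lemma sum_norm_sq_le_chainEnergy {M : ℕ} {s : ℝ} (hs : 1 ≤ s) (x : Fin (M + 1) → ℂ) :
    ∑ i, ‖x i‖ ^ 2 ≤ chainEnergy M (modeCoord s x) := by
  rw [chainEnergy, ← Fin.sum_univ_eq_sum_range (fun j => ‖modeCoord s x j‖ ^ 2) (M + 1)]
  refine Finset.sum_le_sum fun i _ => ?_
  rw [modeCoord, extendZero_val, norm_mul]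
  gcongr
  refine le_mul_of_one_le_left (norm_nonneg _) ?_
  split_ifs
  · simpa using hs.trans (le_abs_self s)
  · simp

lemma chainEnergy_le_sum_norm_sq {M : ℕ} {s : ℝ} (hs : 1 ≤ s) (x : Fin (M + 1) → ℂ) :
    chainEnergy M (modeCoord s x) ≤ s ^ 2 * ∑ i, ‖x i‖ ^ 2 := by
  rw [chainEnergy, ← Fin.sum_univ_eq_sum_range (fun j => ‖modeCoord s x j‖ ^ 2) (M + 1),
    Finset.mul_sum]
  refine Finset.sum_le_sum fun i _ => ?_
  rw [modeCoord, extendZero_val, norm_mul, ← mul_pow]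
  gcongr
  split_ifs
  · simp [abs_of_nonneg (zero_le_one.trans hs)]
  · simpa using hs

/-- Trajectories of the filtered modes decay exponentially, uniformly in the mode. -/
theorem exists_mode_decay {M : ℕ} {k : ℝ} (hk : 0 < k) {h : Fin (M + 1) → ℝ} (hh : IsFilter h) :
    ∃ c : ℝ, 0 < c ∧ ∃ C : ℝ, 0 < C ∧ ∀ m : ℤ, m ≠ 0 → ∀ x : ℝ → Fin (M + 1) → ℂ,
      (∀ t, HasDerivAt x ((modeMatrix k h m).mulVec (x t)) t) →
      ∀ t, 0 ≤ t → ∑ i, ‖x t i‖ ^ 2 ≤ C * Real.exp (-c * t) * ∑ i, ‖x 0 i‖ ^ 2 := by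
  have hext : ∀ j, |extendZero h j| ≤ ∑ i, |h i| := fun j => by
    unfold extendZero
    split_ifs with hj
    · exact Finset.single_le_sum (f := fun i => |h i|) (fun _ _ => abs_nonneg _)
        (Finset.mem_univ _)
    · rw [abs_zero]
      positivity
  have hneg : ∀ j, extendZero h j ≤ 0 := fun j => by
    unfold extendZero
    split_ifs
    · exact hh.nonpos _
    · exact le_rfl
  have hlast : extendZero h M ≠ 0 := by
    have := extendZero_val h (Fin.last M)
    rw [Fin.val_last] at this
    rw [this]
    exact hh.last
  obtain ⟨c, hc, C, hC, hdecay⟩ := exists_chainEnergy_decay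
    (K := Real.sqrt (1 + 1 / k ^ 2) + Real.sqrt (M + 1)) hk hext hneg hlast
  refine ⟨c, hc, C * (1 + 1 / k ^ 2), by positivity, fun m hm x hx t ht => ?_⟩
  set s := Real.sqrt (1 + 1 / ((m : ℝ) * k) ^ 2) with hs
  have hs2 : s ^ 2 = 1 + 1 / ((m : ℝ) * k) ^ 2 := Real.sq_sqrt (by positivity)
  have hs1 : 1 ≤ s := by
    rw [hs, Real.one_le_sqrt]
    exact le_add_of_nonneg_right (by positivity)
  have hb := chainBounds_modeAmplitude (M := M) hk hm (Real.sqrt_nonneg _) hs2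
  have hsk : s ^ 2 ≤ 1 + 1 / k ^ 2 := by
    rw [hs2, ← sq_abs ((m : ℝ) * k)]
    have := hb.le_abs
    gcongr
  have hcoord : ∀ t, ∀ j ≤ M, HasDerivAt (fun t => modeCoord s (x t) j)
      (chainField (m * k) (modeAmplitude s) (extendZero h) (modeCoord s (x t)) j) t := by
    intro t j hj
    rw [← modeCoord_mulVec h hs2 (x t) hj]
    lift j to Fin (M + 1) using Nat.lt_succ_of_le hj
    simp only [modeCoord, extendZero_val]
    exact (hasDerivAt_pi.mp (hx t) j).const_mul _
  have hE := hdecay (m * k) (modeAmplitude s) (fun t => modeCoord s (x t)) hb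
    (fun t i hi => by rw [modeCoord, extendZero_of_lt _ hi, mul_zero]) hcoord t ht
  refine (sum_norm_sq_le_chainEnergy hs1 (x t)).trans (hE.trans ?_)
  have h0 : chainEnergy M (modeCoord s (x 0)) ≤ (1 + 1 / k ^ 2) * ∑ i, ‖x 0 i‖ ^ 2 :=
    (chainEnergy_le_sum_norm_sq hs1 (x 0)).trans (by gcongr)
  calc C * Real.exp (-c * t) * chainEnergy M (modeCoord s (x 0))
      ≤ C * Real.exp (-c * t) * ((1 + 1 / k ^ 2) * ∑ i, ‖x 0 i‖ ^ 2) := by gcongr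
    _ = _ := by ring

/-! ### From decay of trajectories to eigenvalues and operator norm -/

lemma re_le_of_exp_decay {c C : ℝ} {μ : ℂ}
    (h : ∀ t : ℝ, 0 ≤ t → ‖Complex.exp ((t : ℂ) * μ)‖ ^ 2 ≤ C * Real.exp (-c * t)) :
    μ.re ≤ -c / 2 := by
  by_contra! hlt
  have hpos : 0 < 2 * μ.re + c := by linarith
  -- By `1 + x ≤ exp x`, a rate above `-c / 2` would force linear growth below the constant `C`.
  have hC : ∀ t : ℝ, 0 ≤ t → (2 * μ.re + c) * t + 1 ≤ C := fun t ht => by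
    have h1 := mul_le_mul_of_nonneg_right (h t ht) (Real.exp_pos (c * t)).le
    rw [Complex.norm_exp, ← Real.exp_nat_mul, ← Real.exp_add, mul_assoc, ← Real.exp_add] at h1
    simp only [Complex.re_ofReal_mul, neg_mul, neg_add_cancel, Real.exp_zero, mul_one] at h1
    refine (Real.add_one_le_exp _).trans (le_of_eq_of_le ?_ h1)
    congr 1
    push_cast
    ring
  have h0 := hC 0 le_rfl
  have h1 := hC (C / (2 * μ.re + c)) (div_nonneg (by linarith) hpos.le)
  rw [mul_div_cancel₀ _ hpos.ne'] at h1
  linarith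

lemma hasDerivAt_exp_smul_mulVec {n : Type*} [Fintype n] [DecidableEq n] (A : Matrix n n ℂ)
    (v : n → ℂ) (t : ℝ) :
    HasDerivAt (fun t : ℝ => (NormedSpace.exp ((t : ℂ) • A)).mulVec v)
      (A.mulVec ((NormedSpace.exp ((t : ℂ) • A)).mulVec v)) t := by
  have h1 : HasDerivAt (fun z : ℂ => NormedSpace.exp (z • A))
      (A * NormedSpace.exp ((t : ℂ) • A)) (t : ℂ) := hasDerivAt_exp_smul_const' A (t : ℂ)
  have h2 := h1.scomp t Complex.ofRealCLM.hasDerivAt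
  rw [Complex.ofRealCLM_apply, Complex.ofReal_one, one_smul] at h2
  have h3 := ((LinearMap.toContinuousLinearMap
    (((Matrix.mulVecBilin ℝ ℝ).flip v : Matrix n n ℂ →ₗ[ℝ] (n → ℂ)))).hasFDerivAt.comp_hasDerivAt t h2)
  rw [Matrix.mulVec_mulVec]
  exact h3

lemma l2_opNorm_le_of_sum_sq_le {n : Type*} [Fintype n] [DecidableEq n] (A : Matrix n n ℂ)
    {B : ℝ} (hB : 0 ≤ B)
    (h : ∀ v : n → ℂ, ∑ i, ‖A.mulVec v i‖ ^ 2 ≤ B ^ 2 * ∑ i, ‖v i‖ ^ 2) : ‖A‖ ≤ B := by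
  rw [Matrix.cstar_norm_def]
  refine ContinuousLinearMap.opNorm_le_bound _ hB fun v => ?_
  rw [EuclideanSpace.norm_eq, EuclideanSpace.norm_eq, ← Real.sqrt_sq hB,
    ← Real.sqrt_mul (sq_nonneg B)]
  exact Real.sqrt_le_sqrt (h _)

end HermiteFilter

theorem mainTheorem7 (M : ℕ) (k : ℝ) (hk : 0 < k) (h : Fin (M + 1) → ℝ)
    (hh : HermiteFilter.IsFilter h) :
    ∃ lam : ℝ, 0 < lam ∧
      (∀ m : ℤ, m ≠ 0 → ∀ μ : ℂ,
        Module.End.HasEigenvalue (Matrix.toLin' (HermiteFilter.modeMatrix k h m)) μ →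
          μ.re < -lam) ∧
      ∃ C : ℝ, ∀ m : ℤ, m ≠ 0 → ∀ t : ℝ, 0 ≤ t →
        ‖NormedSpace.exp ((t : ℂ) • HermiteFilter.modeMatrix k h m)‖ ≤
          C * (t ^ M + 1) * Real.exp (-lam * t) := by
  obtain ⟨c, hc, C, hC, hdecay⟩ := HermiteFilter.exists_mode_decay hk hh
  -- Trajectories give `μ.re ≤ -c / 2` and norm decay at rate `c / 2`; passing to `c / 4` makes the
  -- eigenvalue bound strict.
  refine ⟨c / 4, by positivity, fun m hm μ hμ => ?_, Real.sqrt C, fun m hm t ht => ?_⟩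
  · obtain ⟨v, hv⟩ := hμ.exists_hasEigenvector
    have hAv : (HermiteFilter.modeMatrix k h m).mulVec v = μ • v := by
      simpa using hv.apply_eq_smul
    have hpos : 0 < ∑ i, ‖v i‖ ^ 2 := by
      obtain ⟨i, hi⟩ := Function.ne_iff.mp hv.2
      exact Finset.sum_pos' (fun _ _ => sq_nonneg _)
        ⟨i, Finset.mem_univ i, by have := norm_pos_iff.mpr hi; positivity⟩
    have hre : μ.re ≤ -c / 2 := by
      refine HermiteFilter.re_le_of_exp_decay (C := C) fun t ht => ?_
      have h1 := hdecay m hm (fun t => Complex.exp ((t : ℂ) * μ) • v) (fun t => ?_) t ht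
      · simp only [Pi.smul_apply, norm_smul, mul_pow, ← Finset.mul_sum, Complex.ofReal_zero,
          zero_mul, Complex.exp_zero, norm_one, one_mul] at h1
        exact le_of_mul_le_mul_right h1 hpos
      · rw [Matrix.mulVec_smul, hAv, smul_smul]
        have h2 : HasDerivAt (fun z : ℂ => Complex.exp (z * μ))
            (Complex.exp ((t : ℂ) * μ) * μ) (t : ℂ) := by
          simpa using ((hasDerivAt_id (t : ℂ)).mul_const μ).cexp
        exact h2.comp_ofReal.smul_const v
    linarith
  · have hexp : 0 < Real.exp (-(c / 4) * t) := Real.exp_pos _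
    have hnorm : ‖NormedSpace.exp ((t : ℂ) • HermiteFilter.modeMatrix k h m)‖ ≤
        Real.sqrt C * Real.exp (-(c / 4) * t) := by
      refine HermiteFilter.l2_opNorm_le_of_sum_sq_le _ (by positivity) fun v => ?_
      have h1 := hdecay m hm _ (HermiteFilter.hasDerivAt_exp_smul_mulVec _ v) t ht
      simp only [Complex.ofReal_zero, zero_smul, NormedSpace.exp_zero, Matrix.one_mulVec] at h1
      refine h1.trans (mul_le_mul_of_nonneg_right ?_ (Finset.sum_nonneg fun _ _ => sq_nonneg _))
      rw [mul_pow, Real.sq_sqrt hC.le, ← Real.exp_nat_mul]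
      refine mul_le_mul_of_nonneg_left (Real.exp_le_exp.mpr ?_) hC.le
      push_cast
      nlinarith
    refine hnorm.trans (mul_le_mul_of_nonneg_right ?_ hexp.le)
    -- The decay is uniform without a polynomial factor; `t ^ M + 1 ≥ 1` only weakens it.
    exact le_mul_of_one_le_right (Real.sqrt_nonneg _) (le_add_of_nonneg_left (by positivity))
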